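/- For complex $q$ with $0<|q|<1$ put $(x;q)_n=\prod_{k=0}^{n-1}(1-xq^k)$, and for complex $a,b$ define $$\mathrm{ab}_i(a,b;q)=\frac{q^{2i-4}(1-bq^{i-3})(1-aq^{i-2})(a-bq^{i-2})(1-q^{i-1})}{(1-bq^{2i-5})(1-bq^{2i-4})^2(1-bq^{2i-3})}\quad(i\ge 2),$$ $$c_1(a,b;q)=\frac{a-1}{b-1},\qquad c_i(a,b;q)=\frac{q^{i-2}\bigl(q+abq^{2i-3}+a(1-q^{i-1}-q^i)+bq^{i-2}(-1-q+q^i)\bigr)}{(1-bq^{2i-4})(1-bq^{2i-2})}\quad(i\ge2).$$ From now on take $(a,b)=(q,q^2)$ and write $\mathrm{ab}_i,c_i$ for $\mathrm{ab}_i(q,q^2;q),\ c_i(q,q^2;q)$. The Stirling $q$-coefficients $\left[{h\atop k}\right]$ are defined for $h\ge0$ by $\left[{h\atop k}\right]=\left[{h-1\atop k}\right]-c_h\left[{h-1\atop k-1}\right]+\delta_{h,0}\delta_{k,0}$, and vanish when $h<0$ or $k<0$. The special sums are $$S_{h,m,s}(z)=\sum_{k_1,\dots,k_m}\ \prod_{i=1}^m\frac{\mathrm{ab}_{k_i}}{(1-c_{k_i}z)(1-c_{k_i-1}z)},$$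 summed over integers with $k_1\ge2$, $k_i\ge k_{i-1}+2$ for $2\le i\le m$, $k_m\le h$ and $k_1+\dots+k_m=s$. They are expanded as power series in $z$; $[z^r]$ of such a series is $0$ for $r<0$. For $j\ge1$ let $$\begin{aligned}\widetilde D_{0,j}(q,z)={}&\sum_{N=0}^{2j+1}z^N\sum_{n=0}^{N}\left[{j+1\atop n}\right]\left[{j\atop N-n}\right]\\ &+\sum_{N=0}^{2j+1}z^N\sum_{n=0}^{N}\ \sum_{\substack{1\le m_1\le\lfloor j/2\rfloor\\1\le m_2\le\lfloor (j+1)/2\rfloor}}\ \sum_{\substack{1\le s_1\le m_1j\\1\le s_2\le m_2(j+1)}}\ \sum_{\substack{1\le k_1\le N-n\\1\le k_2\le n}}\left[{j+1\atop n-k_2}\right]\left[{j\atop N-n-k_1}\right](-1)^{m_1+m_2}\,[z^{k_1-2m_1}]S_{j,m_1,s_1}(z)\,[z^{k_2-2m_2}]S_{j+1,m_2,s_2}(z)\\ &+\sum_{N=0}^{2j+1}z^N\sum_{n=0}^{N}\sum_{m=1}^{\lfloor (j+1)/2\rfloor}\sum_{s=0}^{m(j+1)}\sum_{k=0}^{n}\left[{j+1\atop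 n-k}\right]\left[{j\atop N-n}\right](-1)^m[z^{k-2m}]S_{j+1,m,s}(z)\\ &+\sum_{N=0}^{2j+1}z^N\sum_{n=0}^{N}\sum_{m=1}^{\lfloor j/2\rfloor}\sum_{s=0}^{mj}\sum_{k=0}^{n}\left[{j\atop n-k}\right]\left[{j+1\atop N-n}\right](-1)^m[z^{k-2m}]S_{j,m,s}(z),\end{aligned}$$ and for $h\ge1$ let $$D_{0,h}(q,z)=\frac{q(1+q)}{(1-q)(1+q-z)}+\sum_{j=1}^{h-1}\frac{q\cdot q^{j^2}(q;q)_j^4\,z^{2j}}{(q;q^2)_j^2\,(q^2;q^2)_j^2\,(1-q^{2j+1})}\,\widetilde D_{0,j}(q,z)^{-1}.$$ Let $D_{0,\infty}(q,z)$ be the corresponding infinite sum over all $j\ge1$. Write $d(n)$ for the number of positive divisors of $n\ge 1$, with $d(0)=0$. **Theorem.** For all $q\in\mathbb C$ with $0<|q|<0.206783$ and all $j\ge1$, $\widetilde D_{0,j}(q,q)\ne0$. For every $h\ge2$, the function $q\mapsto D_{0,h}(q,q)$ is given on $0<|q|<0.206783$ by a convergent power series in $q$, whose coefficients satisfy $[q^n]D_{0,h}(q,q)=d(n)$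 for all $0\le n<h$. Moreover, for every $q$ with $0<|q|<0.206783$ the sum defining $D_{0,\infty}(q,q)$ converges absolutely, $D_{0,h}(q,q)\to D_{0,\infty}(q,q)$ as $h\to\infty$, and $$D_{0,\infty}(q,q)=\sum_{n\ge1}\frac{q^n}{1-q^n}=\sum_{m\ge1}d(m)q^m,$$ where both series converge. -/

import Mathlib

noncomputable section

namespace DivisorJFraction

/-- The finite `q`-Pochhammer symbol `(a; q)_n = ∏_{k=0}^{n-1} (1 - a q^k)`. -/
def qPoch (a q : ℂ) (n : ℕ) : ℂ := ∏ k ∈ Finset.range n, (1 - a * q ^ k)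

/-- The J-fraction sequence `ab_i(a, b; q)`, `i ≥ 2`, attached to the ratios `(a; q)_n / (b; q)_n`.
The exponents are integers, since `q^(i-3)` and `q^(2i-5)` are `q⁻¹` at `i = 2`. -/
def ab (a b q : ℂ) (i : ℕ) : ℂ :=
  q ^ (2 * (i : ℤ) - 4) * (1 - b * q ^ ((i : ℤ) - 3)) * (1 - a * q ^ ((i : ℤ) - 2)) *
      (a - b * q ^ ((i : ℤ) - 2)) * (1 - q ^ ((i : ℤ) - 1)) /
    ((1 - b * q ^ (2 * (i : ℤ) - 5)) * (1 - b * q ^ (2 * (i : ℤ) - 4)) ^ 2 *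
      (1 - b * q ^ (2 * (i : ℤ) - 3)))

/-- The J-fraction sequence `c_i(a, b; q)` attached to the ratios `(a; q)_n / (b; q)_n`. -/
def c (a b q : ℂ) (i : ℕ) : ℂ :=
  if 2 ≤ i then
    q ^ ((i : ℤ) - 2) *
        (q + a * b * q ^ (2 * (i : ℤ) - 3) + a * (1 - q ^ ((i : ℤ) - 1) - q ^ (i : ℤ)) +
          b * q ^ ((i : ℤ) - 2) * (-1 - q + q ^ (i : ℤ))) /
      ((1 - b * q ^ (2 * (i : ℤ) - 4)) * (1 - b * q ^ (2 * (i : ℤ) - 2)))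
  else if i = 1 then (a - 1) / (b - 1)
  else 0

/-- The generalized Stirling `q`-coefficients of a sequence `c`:
`[h, k] = [h-1, k] - c_h [h-1, k-1] + δ_{h,0} δ_{k,0}`, zero at negative indices. -/
def stirlingQ (c : ℕ → ℂ) : ℕ → ℕ → ℂ
  | 0, 0 => 1
  | 0, _ + 1 => 0
  | h + 1, 0 => stirlingQ c h 0
  | h + 1, k + 1 => stirlingQ c h (k + 1) - c (h + 1) * stirlingQ c h k

/-- The index tuples `(k_1, …, k_m)` of the nested sum: `2 ≤ k_1`, `k_{i-1} + 2 ≤ k_i`, `k_m ≤ h`,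
and `k_1 + ⋯ + k_m = s`. (The upper limits `k_i ≤ h - 2(m-i)` follow from the gaps.) -/
def nestedIndices (h m s : ℕ) : Finset (Fin m → ℕ) :=
  (Fintype.piFinset fun _ : Fin m => Finset.Icc 2 h).filter fun k =>
    (∀ i j : Fin m, i < j → k i + 2 ≤ k j) ∧ ∑ i, k i = s

/-- The special sum `S_{h,m,s}(z)` as a formal power series in `z`: the sum over all
`(k_1, …, k_m)` as above of `∏_i ab_{k_i} / ((1 - c_{k_i} z) (1 - c_{k_i - 1} z))`. -/
def specialSum (ab c : ℕ → ℂ) (h m s : ℕ) : PowerSeries ℂ :=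
  ∑ k ∈ nestedIndices h m s, ∏ i,
    PowerSeries.C (ab (k i)) *
      ((1 - PowerSeries.C (c (k i)) * PowerSeries.X) *
        (1 - PowerSeries.C (c (k i - 1)) * PowerSeries.X))⁻¹

/-- `[z^(k-r)] f`, which is zero when `k < r`. -/
def coeffShift (f : PowerSeries ℂ) (k r : ℕ) : ℂ :=
  if r ≤ k then PowerSeries.coeff (k - r) f else 0

/-- The Stirling `q`-coefficients for `(a, b) = (q, q²)`. -/
def stir (q : ℂ) : ℕ → ℕ → ℂ := stirlingQ (c q (q ^ 2) q)

/-- The coefficient `[z^(k-2m)] S_{h,m,s}(z)` for `(a, b) = (q, q²)`. -/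
def sCoeff (q : ℂ) (h m s k : ℕ) : ℂ :=
  coeffShift (specialSum (ab q (q ^ 2) q) (c q (q ^ 2) q) h m s) k (2 * m)

/-- The denominators `D̃_{0,j}(q, z)`, as polynomials in `z` with explicit coefficients. -/
def Dtilde (q z : ℂ) (j : ℕ) : ℂ :=
  (∑ N ∈ Finset.range (2 * j + 2), ∑ n ∈ Finset.range (N + 1),
      stir q (j + 1) n * stir q j (N - n) * z ^ N) +
  (∑ N ∈ Finset.range (2 * j + 2), ∑ n ∈ Finset.range (N + 1),
      (∑ m₁ ∈ Finset.Icc 1 (j / 2), ∑ m₂ ∈ Finset.Icc 1 ((j + 1) / 2),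
        ∑ s₁ ∈ Finset.Icc 1 (m₁ * j), ∑ s₂ ∈ Finset.Icc 1 (m₂ * (j + 1)),
        ∑ k₁ ∈ Finset.Icc 1 (N - n), ∑ k₂ ∈ Finset.Icc 1 n,
          stir q (j + 1) (n - k₂) * stir q j (N - n - k₁) * (-1) ^ (m₁ + m₂) *
            sCoeff q j m₁ s₁ k₁ * sCoeff q (j + 1) m₂ s₂ k₂) * z ^ N) +
  (∑ N ∈ Finset.range (2 * j + 2), ∑ n ∈ Finset.range (N + 1),
      (∑ m ∈ Finset.Icc 1 ((j + 1) / 2), ∑ s ∈ Finset.Icc 0 (m * (j + 1)),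
        ∑ k ∈ Finset.Icc 0 n,
          stir q (j + 1) (n - k) * stir q j (N - n) * (-1) ^ m *
            sCoeff q (j + 1) m s k) * z ^ N) +
  (∑ N ∈ Finset.range (2 * j + 2), ∑ n ∈ Finset.range (N + 1),
      (∑ m ∈ Finset.Icc 1 (j / 2), ∑ s ∈ Finset.Icc 0 (m * j),
        ∑ k ∈ Finset.Icc 0 n,
          stir q j (n - k) * stir q (j + 1) (N - n) * (-1) ^ m *
            sCoeff q j m s k) * z ^ N)

/-- The leading term of `D_{0,h}(q, z)`. -/
def D0Head (q z : ℂ) : ℂ := q * (1 + q) / ((1 - q) * (1 + q - z))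

/-- The `j`-th summand, `j ≥ 1`, of `D_{0,h}(q, z)`. -/
def D0Term (q z : ℂ) (j : ℕ) : ℂ :=
  q * q ^ (j ^ 2) * qPoch q q j ^ 4 * z ^ (2 * j) /
      (qPoch q (q ^ 2) j ^ 2 * qPoch (q ^ 2) (q ^ 2) j ^ 2 * (1 - q ^ (2 * j + 1))) *
    (Dtilde q z j)⁻¹

/-- The generating function `D_{0,h}(q, z)`. -/
def D0 (h : ℕ) (q z : ℂ) : ℂ := D0Head q z + ∑ j ∈ Finset.Icc 1 (h - 1), D0Term q z j

/-- The infinite sum `D_{0,∞}(q, z)`. -/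
def D0Inf (q z : ℂ) : ℂ := D0Head q z + ∑' j : ℕ+, D0Term q z j

end DivisorJFraction

end

/-!
For `(a, b) = (q, q²)` the moments are `(a; q)_n / (b; q)_n = (1 - q) / (1 - q^{n+1})`, so that the
J-fraction with coefficients `c_i`, `ab_i` expands `J(z) = ∑_k (1 - q) z^k / (1 - q^{k+1})`, and
`q / (1 - q) · J(q)` is the Lambert series `∑ q^n / (1 - q^n)`.

* By Euler's matching expansion the denominator `Q_h(z)` of the `h`-th convergent is
  `∏_{i≤h} (1 - c_i z) · ∑_m (-1)^m z^{2m} ∑_s S_{h,m,s}(z)` (`linProd_mul_matchingSum`). Hence the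
  four sums defining `D̃_{0,j}` multiply out to `Q_{j+1} Q_j` (`Dtilde_eq_eval`), and `D_{0,h}` is
  `q / (1 - q)` times the `h`-th convergent, written as a telescoping series.

* At `z = q` the recurrence `Q_{n+2} = (1 - c q) Q_{n+1} - ab q² Q_n` is a small perturbation of
  `Q_{n+2} = Q_{n+1}` when `|q| ≤ 0.207`, which gives `|Q_n| ≥ 0.7^n` (`norm_jDenom_ge`). In
  particular nothing vanishes.

* The remainders `R_h = Q_h J - P_h` have the explicit coefficients `remCoeff`: these satisfy the
  recurrence of the J-fraction (`remCoeff_add_two`, a rational identity in `q`, `q^h` and `q^k`) and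
  vanish below degree `2h`. Bounding them by powers of `2` gives `|R_h(q)| ≤ 3 (2|q|)^h`. The
  Casoratian of `Q` and `R` is `∏ ab_i q²`, so `D_{0,h} = L - q / (1 - q) · R_h / Q_h` with `L` the
  Lambert series (`D0_eq_lambert_sub`), and `|D_{0,h} - L| ≤ 3 (3|q|)^h`
  (`norm_D0_sub_lambert_le`).

This one estimate does two things: for fixed `q`, as `3|q| < 1`, it yields the convergence of
`D_{0,h}` to `L` and the absolute convergence of the series; for fixed `h`, as `q → 0`, it shows that
the Taylor coefficients of `D_{0,h}` and `L` agree below degree `h` (`coeff_eq_zero_of_norm_le`).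
-/

noncomputable section
namespace DivisorJFraction

/-! ### Matchings of a path -/

/-- The tuples `(k_1, …, k_m)` with entries in `[2, h]` and consecutive gaps at least `2`: the
matchings of `m` disjoint adjacent pairs `{k_i - 1, k_i}` in `{1, …, h}`. -/
def gapTuples (h m : ℕ) : Finset (Fin m → ℕ) :=
  (Fintype.piFinset fun _ : Fin m => Finset.Icc 2 h).filter fun k =>
    ∀ i j : Fin m, i < j → k i + 2 ≤ k j

/-- The weighted count of the tuples in `gapTuples h m`. -/
def gapSum {R : Type*} [CommRing R] (w : ℕ → R) (h m : ℕ) : R :=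
  ∑ k ∈ gapTuples h m, ∏ i, w (k i)

theorem mem_gapTuples {h m : ℕ} {k : Fin m → ℕ} :
    k ∈ gapTuples h m ↔ (∀ i, 2 ≤ k i ∧ k i ≤ h) ∧ ∀ i j : Fin m, i < j → k i + 2 ≤ k j := by
  simp [gapTuples, Fintype.mem_piFinset]

theorem gapSum_zero_right {R : Type*} [CommRing R] (w : ℕ → R) (h : ℕ) : gapSum w h 0 = 1 := by
  have : gapTuples h 0 = {Fin.elim0} := by
    ext k
    simp [mem_gapTuples, Subsingleton.elim k Fin.elim0]
  simp [gapSum, this]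

theorem gapSum_succ_of_le_one {R : Type*} [CommRing R] (w : ℕ → R) {h : ℕ} (hh : h ≤ 1) (m : ℕ) :
    gapSum w h (m + 1) = 0 := by
  have : gapTuples h (m + 1) = ∅ := by
    ext k
    simp only [mem_gapTuples, Finset.notMem_empty, iff_false]
    intro hk
    have := hk.1 0
    omega
  simp [gapSum, this]

/-- The recursion on the largest entry of the tuple. -/
theorem gapSum_add_two {R : Type*} [CommRing R] (w : ℕ → R) (h m : ℕ) :
    gapSum w (h + 2) (m + 1) = gapSum w (h + 1) (m + 1) + w (h + 2) * gapSum w h m := by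
  rw [gapSum, ← Finset.sum_filter_not_add_sum_filter _ (fun k => k (Fin.last m) = h + 2)]
  congr 1
  · rw [gapSum]
    congr 1
    ext k
    simp only [Finset.mem_filter, mem_gapTuples]
    constructor
    · rintro ⟨⟨h1, h2⟩, h3⟩
      refine ⟨fun i => ⟨(h1 i).1, ?_⟩, h2⟩
      have hl := (h1 (Fin.last m)).2
      rcases (Fin.le_last i).eq_or_lt with rfl | hi
      · omega
      · have := h2 _ _ hi
        omega
    · rintro ⟨h1, h2⟩
      refine ⟨⟨fun i => ⟨(h1 i).1, (h1 i).2.trans (by omega)⟩, h2⟩, ?_⟩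
      have := (h1 (Fin.last m)).2
      omega
  · rw [gapSum, Finset.mul_sum]
    refine Finset.sum_nbij' (fun k => Fin.init k) (fun k => Fin.snoc (α := fun _ => ℕ) k (h + 2))
      ?_ ?_ ?_ ?_ ?_
    · intro k hk
      simp only [Finset.mem_filter, mem_gapTuples] at hk ⊢
      obtain ⟨⟨h1, h2⟩, h3⟩ := hk
      refine ⟨fun i => ⟨(h1 _).1, ?_⟩, fun i j hij => h2 _ _ (by simpa using hij)⟩
      have := h2 i.castSucc (Fin.last m) (Fin.castSucc_lt_last i)
      simp only [Fin.init]
      omega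
    · intro k hk
      simp only [Finset.mem_filter, mem_gapTuples] at hk ⊢
      obtain ⟨h1, h2⟩ := hk
      refine ⟨⟨?_, ?_⟩, by simp⟩
      · intro i
        refine Fin.lastCases ?_ (fun i => ?_) i
        · simp
        · have := h1 i
          simp only [Fin.snoc_castSucc]
          omega
      · intro i j
        refine Fin.lastCases ?_ (fun j => ?_) j
        · refine Fin.lastCases ?_ (fun i => ?_) i
          · simp
          · intro _
            simpa using (h1 i).2
        · refine Fin.lastCases ?_ (fun i => ?_) i
          · intro hij
            exact absurd hij (not_lt.mpr (Fin.le_last _))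
          · intro hij
            simpa using h2 i j (by simpa using hij)
    · intro k hk
      simp only [Finset.mem_filter] at hk
      simp only [← hk.2, Fin.snoc_init_self]
    · intro k _
      simp
    · intro k hk
      simp only [Finset.mem_filter] at hk
      rw [Fin.prod_univ_castSucc, hk.2, mul_comm]
      rfl

theorem gapSum_eq_zero {R : Type*} [CommRing R] (w : ℕ → R) :
    ∀ {h m : ℕ}, h < 2 * m → gapSum w h m = 0
  | 0, 0, hm | 1, 0, hm | _ + 2, 0, hm => by omega
  | 0, m + 1, _ => gapSum_succ_of_le_one w (by omega) m
  | 1, m + 1, _ => gapSum_succ_of_le_one w le_rfl m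
  | h + 2, m + 1, hm => by
    rw [gapSum_add_two, gapSum_eq_zero w (by omega), gapSum_eq_zero w (by omega), mul_zero,
      add_zero]

/-- The alternating generating function `∑_m (-1)^m y^m gapSum w h m` of the weighted matchings. -/
def matchingSum {R : Type*} [CommRing R] (w : ℕ → R) (y : R) (h : ℕ) : R :=
  1 + ∑ m ∈ Finset.Icc 1 (h / 2), (-1) ^ m * y ^ m * gapSum w h m

theorem matchingSum_eq_sum_range {R : Type*} [CommRing R] (w : ℕ → R) (y : R) {h M : ℕ}
    (hM : h / 2 < M) :
    matchingSum w y h = ∑ m ∈ Finset.range M, (-1) ^ m * y ^ m * gapSum w h m := by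
  rw [← Finset.sum_subset (Finset.range_subset_range.mpr (Nat.succ_le_of_lt hM)),
    Finset.sum_range_succ', matchingSum, add_comm]
  · congr 1
    · rw [← Finset.Ico_add_one_right_eq_Icc, Finset.sum_Ico_eq_sum_range]
      simp only [add_tsub_cancel_right, add_comm 1]
    · simp [gapSum_zero_right]
  · intro m _ hm
    rw [Finset.mem_range] at hm
    rw [gapSum_eq_zero w (by omega), mul_zero]

theorem matchingSum_zero {R : Type*} [CommRing R] (w : ℕ → R) (y : R) :
    matchingSum w y 0 = 1 := by simp [matchingSum]

theorem matchingSum_one {R : Type*} [CommRing R] (w : ℕ → R) (y : R) :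
    matchingSum w y 1 = 1 := by simp [matchingSum]

theorem matchingSum_add_two {R : Type*} [CommRing R] (w : ℕ → R) (y : R) (h : ℕ) :
    matchingSum w y (h + 2) = matchingSum w y (h + 1) - y * w (h + 2) * matchingSum w y h := by
  rw [matchingSum_eq_sum_range w y (show (h + 2) / 2 < h + 4 by omega),
    matchingSum_eq_sum_range w y (show (h + 1) / 2 < h + 4 by omega),
    matchingSum_eq_sum_range w y (show h / 2 < h + 3 by omega),
    Finset.sum_range_succ' _ (h + 3), Finset.sum_range_succ' _ (h + 3), Finset.mul_sum,
    add_sub_right_comm, ← Finset.sum_sub_distrib]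
  congr 1
  refine Finset.sum_congr rfl fun m _ => ?_
  rw [gapSum_add_two]
  ring

/-! ### The J-fraction denominators and `D̃_{0,j}` -/

/-- The weight of the pair `{k - 1, k}` in `S_{h,m,s}(z)`. -/
def pairWeight (ab c : ℕ → ℂ) (k : ℕ) : PowerSeries ℂ :=
  PowerSeries.C (ab k) *
    ((1 - PowerSeries.C (c k) * PowerSeries.X) *
      (1 - PowerSeries.C (c (k - 1)) * PowerSeries.X))⁻¹

theorem sum_specialSum (ab c : ℕ → ℂ) {h m : ℕ} {T : Finset ℕ}
    (hT : ∀ k ∈ gapTuples h m, ∑ i, k i ∈ T) :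
    ∑ s ∈ T, specialSum ab c h m s = gapSum (pairWeight ab c) h m := by
  rw [gapSum, ← Finset.sum_fiberwise_of_maps_to hT]
  refine Finset.sum_congr rfl fun s _ => ?_
  rw [specialSum, nestedIndices, gapTuples, Finset.filter_filter]
  rfl

theorem sum_mem_Icc_of_mem_gapTuples {h m : ℕ} (hm : 1 ≤ m) {k : Fin m → ℕ}
    (hk : k ∈ gapTuples h m) : ∑ i, k i ∈ Finset.Icc 1 (m * h) := by
  rw [mem_gapTuples] at hk
  rw [Finset.mem_Icc]
  constructor
  · have := Finset.single_le_sum (f := k) (fun _ _ => Nat.zero_le _) (Finset.mem_univ ⟨0, hm⟩)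
    have := hk.1 ⟨0, hm⟩
    omega
  · calc ∑ i, k i ≤ ∑ _i : Fin m, h := Finset.sum_le_sum fun i _ => (hk.1 i).2
      _ = m * h := by simp

/-- The product `∏_{i=1}^{h} (1 - c_i z)`, whose coefficients are the Stirling coefficients. -/
def linProd (c : ℕ → ℂ) (h : ℕ) : PowerSeries ℂ :=
  ∏ i ∈ Finset.range h, (1 - PowerSeries.C (c (i + 1)) * PowerSeries.X)

theorem stirlingQ_eq_coeff (c : ℕ → ℂ) :
    ∀ h k : ℕ, stirlingQ c h k = PowerSeries.coeff k (linProd c h)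
  | 0, 0 => by simp [stirlingQ, linProd]
  | 0, k + 1 => by simp [stirlingQ, linProd, PowerSeries.coeff_one]
  | h + 1, 0 => by
    rw [stirlingQ, stirlingQ_eq_coeff c h 0, linProd, linProd, Finset.prod_range_succ]
    simp
  | h + 1, k + 1 => by
    rw [stirlingQ, stirlingQ_eq_coeff c h (k + 1), stirlingQ_eq_coeff c h k, linProd, linProd,
      Finset.prod_range_succ, mul_sub, mul_one, map_sub, mul_comm (∏ _ ∈ _, _), mul_assoc,
      PowerSeries.coeff_C_mul, PowerSeries.coeff_succ_X_mul]

/-- The denominators of the convergents of the J-fraction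
`1 / (1 - c_1 z - ab_2 z² / (1 - c_2 z - ab_3 z² / ⋯))`. -/
def convDenom (ab c : ℕ → ℂ) : ℕ → Polynomial ℂ
  | 0 => 1
  | 1 => 1 - Polynomial.C (c 1) * Polynomial.X
  | n + 2 => (1 - Polynomial.C (c (n + 2)) * Polynomial.X) * convDenom ab c (n + 1) -
      Polynomial.C (ab (n + 2)) * Polynomial.X ^ 2 * convDenom ab c n

theorem natDegree_convDenom_le (ab c : ℕ → ℂ) :
    ∀ h : ℕ, (convDenom ab c h).natDegree ≤ h
  | 0 => by simp [convDenom]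
  | 1 => by rw [convDenom]; compute_degree
  | n + 2 => by
    have h1 := natDegree_convDenom_le ab c (n + 1)
    have h2 := natDegree_convDenom_le ab c n
    rw [convDenom]
    refine (Polynomial.natDegree_sub_le _ _).trans (max_le ?_ ?_)
    · refine Polynomial.natDegree_mul_le.trans ?_
      have : (1 - Polynomial.C (c (n + 2)) * Polynomial.X).natDegree ≤ 1 := by compute_degree
      omega
    · refine Polynomial.natDegree_mul_le.trans ?_
      have : (Polynomial.C (ab (n + 2)) * Polynomial.X ^ 2).natDegree ≤ 2 := by compute_degree
      omega

/-- Euler's matching expansion of the denominators of the convergents. -/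
theorem linProd_mul_matchingSum (ab c : ℕ → ℂ) :
    ∀ h : ℕ, linProd c h * matchingSum (pairWeight ab c) (PowerSeries.X ^ 2) h =
      (convDenom ab c h : PowerSeries ℂ)
  | 0 => by simp [linProd, matchingSum_zero, convDenom]
  | 1 => by simp [linProd, matchingSum_one, convDenom]
  | n + 2 => by
    have h1 := linProd_mul_matchingSum ab c (n + 1)
    have h2 := linProd_mul_matchingSum ab c n
    have key : (1 - PowerSeries.C (c (n + 2)) * PowerSeries.X) *
        (1 - PowerSeries.C (c (n + 1)) * PowerSeries.X) * pairWeight ab c (n + 2) =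
        PowerSeries.C (ab (n + 2)) := by
      rw [pairWeight, mul_left_comm, show n + 2 - 1 = n + 1 from rfl, PowerSeries.mul_inv_cancel,
        mul_one]
      simp
    have e1 : linProd c (n + 1) =
        linProd c n * (1 - PowerSeries.C (c (n + 1)) * PowerSeries.X) :=
      Finset.prod_range_succ _ _
    have e2 : linProd c (n + 2) =
        linProd c (n + 1) * (1 - PowerSeries.C (c (n + 2)) * PowerSeries.X) :=
      Finset.prod_range_succ _ _
    rw [convDenom, Polynomial.coe_sub, Polynomial.coe_mul, Polynomial.coe_mul, ← h1, ← h2,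
      matchingSum_add_two]
    simp only [Polynomial.coe_sub, Polynomial.coe_one, Polynomial.coe_mul, Polynomial.coe_C,
      Polynomial.coe_X, Polynomial.coe_pow]
    rw [← key, e2, e1]
    ring

/-- The matching series without its constant term. -/
def matchingTail (ab c : ℕ → ℂ) (h : ℕ) : PowerSeries ℂ :=
  ∑ m ∈ Finset.Icc 1 (h / 2), (-1) ^ m * (PowerSeries.X ^ 2) ^ m * gapSum (pairWeight ab c) h m

/-- The range `T` of the total `s` may be any set containing `[1, m h]`: all tuples have their sum
there. -/
theorem coeff_matchingTail (ab c : ℕ → ℂ) {h : ℕ} {T : ℕ → Finset ℕ}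
    (hT : ∀ m, 1 ≤ m → Finset.Icc 1 (m * h) ⊆ T m) (k : ℕ) :
    PowerSeries.coeff k (matchingTail ab c h) =
      ∑ m ∈ Finset.Icc 1 (h / 2), ∑ s ∈ T m,
        (-1) ^ m * coeffShift (specialSum ab c h m s) k (2 * m) := by
  rw [matchingTail, map_sum]
  refine Finset.sum_congr rfl fun m hm => ?_
  have hm := (Finset.mem_Icc.mp hm).1
  rw [← sum_specialSum ab c (T := T m)
    fun k hk => hT m hm (sum_mem_Icc_of_mem_gapTuples hm hk), Finset.mul_sum, map_sum]
  refine Finset.sum_congr rfl fun s _ => ?_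
  rw [← pow_mul, mul_assoc, show ((-1 : PowerSeries ℂ)) ^ m = PowerSeries.C ((-1) ^ m) by simp,
    PowerSeries.coeff_C_mul, PowerSeries.coeff_X_pow_mul']
  rfl

theorem coeff_linProd_mul_matchingTail (ab c : ℕ → ℂ) {h : ℕ} {T : ℕ → Finset ℕ}
    (hT : ∀ m, 1 ≤ m → Finset.Icc 1 (m * h) ⊆ T m) (n : ℕ) :
    PowerSeries.coeff n (linProd c h * matchingTail ab c h) =
      ∑ m ∈ Finset.Icc 1 (h / 2), ∑ s ∈ T m, ∑ k ∈ Finset.Icc 0 n,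
        stirlingQ c h (n - k) * (-1) ^ m * coeffShift (specialSum ab c h m s) k (2 * m) := by
  rw [mul_comm, PowerSeries.coeff_mul, Finset.Nat.sum_antidiagonal_eq_sum_range_succ
    (fun k l => PowerSeries.coeff k (matchingTail ab c h) * PowerSeries.coeff l (linProd c h))]
  simp only [coeff_matchingTail ab c hT, ← stirlingQ_eq_coeff, Finset.sum_mul]
  rw [Finset.sum_comm]
  refine Finset.sum_congr rfl fun m _ => ?_
  rw [Finset.sum_comm]
  refine Finset.sum_congr rfl fun s _ => ?_
  rw [Nat.range_succ_eq_Icc_zero]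
  refine Finset.sum_congr rfl fun k _ => ?_
  ring

theorem sum_Icc_zero_coeffShift (f : PowerSeries ℂ) {m : ℕ} (hm : 1 ≤ m) (n : ℕ) (g : ℕ → ℂ) :
    ∑ k ∈ Finset.Icc 0 n, g k * coeffShift f k (2 * m) =
      ∑ k ∈ Finset.Icc 1 n, g k * coeffShift f k (2 * m) := by
  rw [← Finset.insert_Icc_succ_left_eq_Icc (Nat.zero_le n), Finset.sum_insert (by simp)]
  simp [coeffShift, show m ≠ 0 by omega]

/-- The polynomial `D̃_{0,j}` is the product of two consecutive denominators: its four sums are the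
expansion of `(A + A U) (B + B V)`, where `A`, `B` are the Stirling parts and `A U`, `B V` the
parts of the denominators coming from nonempty matchings. -/
theorem Dtilde_eq_eval (q z : ℂ) (j : ℕ) :
    Dtilde q z j = (convDenom (ab q (q ^ 2) q) (c q (q ^ 2) q) (j + 1)).eval z *
      (convDenom (ab q (q ^ 2) q) (c q (q ^ 2) q) j).eval z := by
  set u := ab q (q ^ 2) q with hu
  set v := c q (q ^ 2) q with hv
  -- the truncation at degree `2j + 1` loses nothing
  have hdeg : (convDenom u v (j + 1) * convDenom u v j).natDegree < 2 * j + 2 := by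
    have h1 := natDegree_convDenom_le u v (j + 1)
    have h2 := natDegree_convDenom_le u v j
    have h3 := Polynomial.natDegree_mul_le (p := convDenom u v (j + 1)) (q := convDenom u v j)
    omega
  have hQ : ∀ h, (convDenom u v h : PowerSeries ℂ) =
      linProd v h + linProd v h * matchingTail u v h := fun h => by
    rw [← linProd_mul_matchingSum, matchingSum, matchingTail, mul_add, mul_one]
  have hIcc : ∀ h m : ℕ, 1 ≤ m → Finset.Icc 1 (m * h) ⊆ Finset.Icc 0 (m * h) := fun h m _ =>
    Finset.Icc_subset_Icc_left (Nat.zero_le 1)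
  rw [← Polynomial.eval_mul, Polynomial.eval_eq_sum_range' hdeg, Dtilde,
    ← Finset.sum_add_distrib, ← Finset.sum_add_distrib, ← Finset.sum_add_distrib]
  refine Finset.sum_congr rfl fun N _ => ?_
  rw [← Polynomial.coeff_coe, Polynomial.coe_mul, hQ, hQ,
    show (linProd v (j + 1) + linProd v (j + 1) * matchingTail u v (j + 1)) *
      (linProd v j + linProd v j * matchingTail u v j) =
      linProd v (j + 1) * linProd v j +
      (linProd v (j + 1) * matchingTail u v (j + 1)) * (linProd v j * matchingTail u v j) +
      (linProd v (j + 1) * matchingTail u v (j + 1)) * linProd v j +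
      (linProd v j * matchingTail u v j) * linProd v (j + 1) by ring,
    map_add, map_add, map_add, add_mul, add_mul, add_mul]
  simp only [PowerSeries.coeff_mul N]
  rw [Finset.Nat.sum_antidiagonal_eq_sum_range_succ
      (fun k l => PowerSeries.coeff k (linProd v (j + 1)) * PowerSeries.coeff l (linProd v j)),
    Finset.Nat.sum_antidiagonal_eq_sum_range_succ
      (fun k l => PowerSeries.coeff k (linProd v (j + 1) * matchingTail u v (j + 1)) *
        PowerSeries.coeff l (linProd v j * matchingTail u v j)),
    Finset.Nat.sum_antidiagonal_eq_sum_range_succ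
      (fun k l => PowerSeries.coeff k (linProd v (j + 1) * matchingTail u v (j + 1)) *
        PowerSeries.coeff l (linProd v j)),
    Finset.Nat.sum_antidiagonal_eq_sum_range_succ
      (fun k l => PowerSeries.coeff k (linProd v j * matchingTail u v j) *
        PowerSeries.coeff l (linProd v (j + 1))),
    Finset.sum_mul, Finset.sum_mul, Finset.sum_mul, Finset.sum_mul]
  congr 1
  · congr 1
    · congr 1
      · refine Finset.sum_congr rfl fun n _ => ?_
        rw [stir, stirlingQ_eq_coeff, stirlingQ_eq_coeff]
      · refine Finset.sum_congr rfl fun n _ => ?_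
        rw [coeff_linProd_mul_matchingTail u v (T := fun m => Finset.Icc 1 (m * (j + 1)))
            (fun _ _ => subset_rfl),
          coeff_linProd_mul_matchingTail u v (T := fun m => Finset.Icc 1 (m * j))
            (fun _ _ => subset_rfl)]
        refine congrArg (· * z ^ N) ?_
        rw [mul_comm (Finset.sum (Finset.Icc 1 ((j + 1) / 2)) _), Finset.sum_mul_sum]
        refine Finset.sum_congr rfl fun m₁ hm₁ => Finset.sum_congr rfl fun m₂ hm₂ => ?_
        rw [Finset.sum_mul_sum]
        refine Finset.sum_congr rfl fun s₁ _ => Finset.sum_congr rfl fun s₂ _ => ?_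
        rw [sum_Icc_zero_coeffShift _ (Finset.mem_Icc.mp hm₁).1,
          sum_Icc_zero_coeffShift _ (Finset.mem_Icc.mp hm₂).1, Finset.sum_mul_sum]
        refine Finset.sum_congr rfl fun k₁ _ => Finset.sum_congr rfl fun k₂ _ => ?_
        rw [stir, sCoeff, sCoeff, pow_add]
        ring
    · refine Finset.sum_congr rfl fun n _ => ?_
      rw [coeff_linProd_mul_matchingTail u v (hIcc (j + 1)), ← stirlingQ_eq_coeff]
      simp only [Finset.sum_mul]
      refine Finset.sum_congr rfl fun m _ => Finset.sum_congr rfl fun s _ =>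
        Finset.sum_congr rfl fun k _ => ?_
      rw [stir, sCoeff]
      ring
  · refine Finset.sum_congr rfl fun n _ => ?_
    rw [coeff_linProd_mul_matchingTail u v (hIcc j), ← stirlingQ_eq_coeff]
    simp only [Finset.sum_mul]
    refine Finset.sum_congr rfl fun m _ => Finset.sum_congr rfl fun s _ =>
      Finset.sum_congr rfl fun k _ => ?_
    rw [stir, sCoeff]
    ring

/-! ### The coefficients for `(a, b) = (q, q²)` and bounds on the denominators -/

/-- The coefficient `c_{n+1}(q, q²; q)` in lowest terms. -/
def jC (q : ℂ) (n : ℕ) : ℂ := 2 * q ^ n / ((1 + q ^ n) * (1 + q ^ (n + 1)))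

/-- The coefficient `ab_{n+2}(q, q²; q)` in lowest terms. -/
def jAB (q : ℂ) (n : ℕ) : ℂ :=
  q ^ (2 * n + 1) * (1 - q ^ (n + 1)) ^ 2 /
    ((1 - q ^ (2 * n + 1)) * (1 + q ^ (n + 1)) ^ 2 * (1 - q ^ (2 * n + 3)))

/-- The values at `z = q` of the denominators of the convergents. Being written with the reduced
coefficients, they make sense and are holomorphic at `q = 0` as well. -/
def jDenom (q : ℂ) : ℕ → ℂ
  | 0 => 1
  | 1 => 1 - jC q 0 * q
  | n + 2 => (1 - jC q (n + 1) * q) * jDenom q (n + 1) - jAB q n * q ^ 2 * jDenom q n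

theorem norm_pow_succ_le {q : ℂ} (hq : ‖q‖ ≤ 0.207) (n : ℕ) : ‖q ^ (n + 1)‖ ≤ 0.207 := by
  rw [norm_pow]
  exact (pow_le_of_le_one (norm_nonneg q) (by linarith) (by omega)).trans hq

theorem norm_one_sub_pow_ge {q : ℂ} (hq : ‖q‖ ≤ 0.207) (n : ℕ) : 0.793 ≤ ‖1 - q ^ (n + 1)‖ := by
  have h1 := norm_pow_succ_le hq n
  have h2 := norm_sub_norm_le 1 (q ^ (n + 1))
  rw [norm_one] at h2
  linarith

theorem norm_one_add_pow_ge {q : ℂ} (hq : ‖q‖ ≤ 0.207) (n : ℕ) : 0.793 ≤ ‖1 + q ^ (n + 1)‖ := by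
  have h1 := norm_pow_succ_le hq n
  have h2 := norm_sub_norm_le 1 (-q ^ (n + 1))
  rw [norm_one, norm_neg, sub_neg_eq_add] at h2
  linarith

theorem norm_one_sub_pow_le {q : ℂ} (hq : ‖q‖ ≤ 0.207) (n : ℕ) : ‖1 - q ^ (n + 1)‖ ≤ 1.207 := by
  have h1 := norm_pow_succ_le hq n
  have h2 := norm_sub_le 1 (q ^ (n + 1))
  rw [norm_one] at h2
  linarith

theorem one_sub_pow_ne_zero {q : ℂ} (hq : ‖q‖ ≤ 0.207) (n : ℕ) : 1 - q ^ (n + 1) ≠ 0 :=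
  norm_pos_iff.mp (lt_of_lt_of_le (by norm_num) (norm_one_sub_pow_ge hq n))

theorem one_add_pow_ne_zero {q : ℂ} (hq : ‖q‖ ≤ 0.207) (n : ℕ) : 1 + q ^ (n + 1) ≠ 0 :=
  norm_pos_iff.mp (lt_of_lt_of_le (by norm_num) (norm_one_add_pow_ge hq n))

theorem one_add_pow_ne_zero' {q : ℂ} (hq : ‖q‖ ≤ 0.207) : ∀ n : ℕ, 1 + q ^ n ≠ 0
  | 0 => by norm_num
  | n + 1 => one_add_pow_ne_zero hq n

theorem c_eq_jC {q : ℂ} (hq : ‖q‖ ≤ 0.207) (n : ℕ) :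
    c q (q ^ 2) q (n + 1) = jC q n := by
  have h1 : 1 - q ≠ 0 := by simpa using one_sub_pow_ne_zero hq 0
  have h1' : 1 + q ≠ 0 := by simpa using one_add_pow_ne_zero hq 0
  rcases n with _ | n
  · have h2 : q ^ 2 - 1 ≠ 0 := by
      rw [show q ^ 2 - 1 = -((1 - q) * (1 + q)) by ring]
      exact neg_ne_zero.mpr (mul_ne_zero h1 h1')
    simp only [c, jC]
    norm_num
    field_simp
    ring
  · have a1 := one_sub_pow_ne_zero hq n
    have a2 := one_sub_pow_ne_zero hq (n + 1)
    have a3 := one_add_pow_ne_zero hq n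
    have a4 := one_add_pow_ne_zero hq (n + 1)
    have e1 : 1 - q ^ 2 * q ^ (2 * ((n + 1 + 1 : ℕ) : ℤ) - 4) =
        (1 - q ^ (n + 1)) * (1 + q ^ (n + 1)) := by
      rw [show 2 * ((n + 1 + 1 : ℕ) : ℤ) - 4 = ((2 * n : ℕ) : ℤ) by push_cast; ring, zpow_natCast]
      ring
    have e2 : 1 - q ^ 2 * q ^ (2 * ((n + 1 + 1 : ℕ) : ℤ) - 2) =
        (1 - q ^ (n + 2)) * (1 + q ^ (n + 2)) := by
      rw [show 2 * ((n + 1 + 1 : ℕ) : ℤ) - 2 = ((2 * n + 2 : ℕ) : ℤ) by push_cast; ring,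
        zpow_natCast]
      ring
    rw [c, if_pos (by omega), jC, e1, e2,
      show 2 * ((n + 1 + 1 : ℕ) : ℤ) - 3 = ((2 * n + 1 : ℕ) : ℤ) by push_cast; ring,
      show ((n + 1 + 1 : ℕ) : ℤ) - 2 = ((n : ℕ) : ℤ) by push_cast; ring,
      show ((n + 1 + 1 : ℕ) : ℤ) - 1 = ((n + 1 : ℕ) : ℤ) by push_cast; ring]
    simp only [zpow_natCast]
    rw [div_eq_div_iff (mul_ne_zero (mul_ne_zero a1 a3) (mul_ne_zero a2 a4)) (mul_ne_zero a3 a4)]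
    ring

theorem ab_eq_jAB {q : ℂ} (h0 : q ≠ 0) (hq : ‖q‖ ≤ 0.207) (n : ℕ) :
    ab q (q ^ 2) q (n + 2) = jAB q n := by
  have a1 := one_sub_pow_ne_zero hq n
  have a3 := one_add_pow_ne_zero hq n
  have a4 := one_sub_pow_ne_zero hq (2 * n)
  have a5 := one_sub_pow_ne_zero hq (2 * n + 2)
  have e1 : 1 - q ^ 2 * q ^ (2 * ((n + 2 : ℕ) : ℤ) - 4) =
      (1 - q ^ (n + 1)) * (1 + q ^ (n + 1)) := by
    rw [show 2 * ((n + 2 : ℕ) : ℤ) - 4 = ((2 * n : ℕ) : ℤ) by push_cast; ring, zpow_natCast]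
    ring
  have e2 : q ^ 2 * q ^ (((n + 2 : ℕ) : ℤ) - 3) = q ^ (n + 1) := by
    rw [← zpow_natCast, ← zpow_natCast, ← zpow_add₀ h0]
    congr 1
    push_cast
    ring
  have e3 : q ^ 2 * q ^ (2 * ((n + 2 : ℕ) : ℤ) - 5) = q ^ (2 * n + 1) := by
    rw [← zpow_natCast, ← zpow_natCast, ← zpow_add₀ h0]
    congr 1
    push_cast
    ring
  rw [ab, jAB, e1, e2, e3,
    show 2 * ((n + 2 : ℕ) : ℤ) - 4 = ((2 * n : ℕ) : ℤ) by push_cast; ring,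
    show 2 * ((n + 2 : ℕ) : ℤ) - 3 = ((2 * n + 1 : ℕ) : ℤ) by push_cast; ring,
    show ((n + 2 : ℕ) : ℤ) - 2 = ((n : ℕ) : ℤ) by push_cast; ring,
    show ((n + 2 : ℕ) : ℤ) - 1 = ((n + 1 : ℕ) : ℤ) by push_cast; ring]
  simp only [zpow_natCast]
  rw [show 1 - q ^ 2 * q ^ (2 * n + 1) = 1 - q ^ (2 * n + 3) by ring]
  field_simp
  ring

theorem eval_convDenom {q : ℂ} (h0 : q ≠ 0) (hq : ‖q‖ ≤ 0.207) :
    ∀ n : ℕ, (convDenom (ab q (q ^ 2) q) (c q (q ^ 2) q) n).eval q = jDenom q n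
  | 0 => by simp [convDenom, jDenom]
  | 1 => by simp [convDenom, jDenom, ← c_eq_jC hq]
  | n + 2 => by
    simp [convDenom, jDenom, ← c_eq_jC hq, ← ab_eq_jAB h0 hq, eval_convDenom h0 hq n,
      eval_convDenom h0 hq (n + 1)]

theorem norm_jC_zero_mul_le {q : ℂ} (hq : ‖q‖ ≤ 0.207) : ‖jC q 0 * q‖ ≤ 0.3 := by
  have h1 := norm_one_add_pow_ge hq 0
  rw [zero_add, pow_one] at h1
  have : jC q 0 * q = q / (1 + q) := by
    have h : 1 + q ≠ 0 := by simpa using one_add_pow_ne_zero hq 0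
    simp only [jC, pow_zero, zero_add, pow_one]
    field_simp
    ring
  rw [this, norm_div, div_le_iff₀ (by linarith)]
  linarith

theorem norm_jC_succ_mul_le {q : ℂ} (hq : ‖q‖ ≤ 0.207) (n : ℕ) :
    ‖jC q (n + 1) * q‖ ≤ 0.14 := by
  have h1 := norm_one_add_pow_ge hq n
  have h2 := norm_one_add_pow_ge hq (n + 1)
  have h3 := norm_pow_succ_le hq n
  rw [jC, div_mul_eq_mul_div, norm_div, norm_mul, norm_mul, norm_mul, Complex.norm_ofNat]
  calc 2 * ‖q ^ (n + 1)‖ * ‖q‖ / (‖1 + q ^ (n + 1)‖ * ‖1 + q ^ (n + 1 + 1)‖)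
      ≤ 2 * 0.207 * 0.207 / (0.793 * 0.793) := by gcongr
    _ ≤ 0.14 := by norm_num

theorem norm_jAB_mul_le {q : ℂ} (hq : ‖q‖ ≤ 0.207) (n : ℕ) :
    ‖jAB q n * q ^ 2‖ ≤ 0.04 := by
  have h1 := norm_one_sub_pow_ge hq (2 * n)
  have h2 := norm_one_sub_pow_ge hq (2 * n + 2)
  have h3 := norm_one_add_pow_ge hq n
  have h4 := norm_pow_succ_le hq (2 * n)
  have h5 := norm_one_sub_pow_le hq n
  rw [jAB, div_mul_eq_mul_div, norm_div, norm_mul, norm_mul, norm_mul, norm_mul, norm_pow (1 - _),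
    norm_pow (1 + _), norm_pow q 2]
  calc ‖q ^ (2 * n + 1)‖ * ‖1 - q ^ (n + 1)‖ ^ 2 * ‖q‖ ^ 2 /
        (‖1 - q ^ (2 * n + 1)‖ * ‖1 + q ^ (n + 1)‖ ^ 2 * ‖1 - q ^ (2 * n + 3)‖)
      ≤ 0.207 * 1.207 ^ 2 * 0.207 ^ 2 / (0.793 * 0.793 ^ 2 * 0.793) := by gcongr
    _ ≤ 0.04 := by norm_num

/-- Consecutive denominators have ratio within `0.3` of `1`, since all the coefficients of the
recurrence but the leading `1` are small. -/
theorem jDenom_ratio {q : ℂ} (hq : ‖q‖ ≤ 0.207) :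
    ∀ n : ℕ, ‖jDenom q (n + 1) - jDenom q n‖ ≤ 0.3 * ‖jDenom q n‖
  | 0 => by
    have := norm_jC_zero_mul_le hq
    simpa [jDenom] using this
  | n + 1 => by
    have h1 := jDenom_ratio hq n
    have h2 := norm_jC_succ_mul_le hq n
    have h3 := norm_jAB_mul_le hq n
    -- `0.14 + 0.04 / 0.7 ≤ 0.3`
    have h4 : 0.7 * ‖jDenom q n‖ ≤ ‖jDenom q (n + 1)‖ := by
      have := norm_sub_norm_le (jDenom q n) (jDenom q (n + 1))
      rw [norm_sub_rev] at this
      linarith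
    have e : jDenom q (n + 1 + 1) - jDenom q (n + 1) =
        -(jC q (n + 1) * q * jDenom q (n + 1)) - jAB q n * q ^ 2 * jDenom q n := by
      rw [jDenom]
      ring
    rw [e]
    refine (norm_sub_le _ _).trans ?_
    rw [norm_neg, norm_mul _ (jDenom q (n + 1)), norm_mul _ (jDenom q n)]
    have h5 := mul_le_mul_of_nonneg_right h2 (norm_nonneg (jDenom q (n + 1)))
    have h6 := mul_le_mul_of_nonneg_right h3 (norm_nonneg (jDenom q n))
    have h7 := norm_nonneg (jDenom q n)
    linarith

theorem norm_jDenom_ge {q : ℂ} (hq : ‖q‖ ≤ 0.207) : ∀ n : ℕ, 0.7 ^ n ≤ ‖jDenom q n‖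
  | 0 => by simp [jDenom]
  | n + 1 => by
    have h1 := jDenom_ratio hq n
    have h2 := norm_jDenom_ge hq n
    have h3 := norm_sub_norm_le (jDenom q n) (jDenom q (n + 1))
    rw [norm_sub_rev] at h3
    rw [pow_succ]
    linarith

theorem jDenom_ne_zero {q : ℂ} (hq : ‖q‖ ≤ 0.207) (n : ℕ) : jDenom q n ≠ 0 :=
  norm_pos_iff.mp (lt_of_lt_of_le (by positivity) (norm_jDenom_ge hq n))

theorem Dtilde_eq_jDenom {q : ℂ} (h0 : q ≠ 0) (hq : ‖q‖ ≤ 0.207) (j : ℕ) :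
    Dtilde q q j = jDenom q (j + 1) * jDenom q j := by
  rw [Dtilde_eq_eval, eval_convDenom h0 hq, eval_convDenom h0 hq]

/-! ### The truncations as telescoping sums -/

/-- The Casoratian `∏_{i=2}^{j+1} ab_i q²` of the denominators and the remainders. -/
def jCas (q : ℂ) (j : ℕ) : ℂ := ∏ i ∈ Finset.range j, jAB q i * q ^ 2

theorem D0Term_eq {q : ℂ} (h0 : q ≠ 0) (hq : ‖q‖ ≤ 0.207) (j : ℕ) :
    D0Term q q j = q / (1 - q) * (jCas q j / (jDenom q j * jDenom q (j + 1))) := by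
  have h1 : 1 - q ≠ 0 := by simpa using one_sub_pow_ne_zero hq 0
  have key : q * q ^ (j ^ 2) * qPoch q q j ^ 4 * q ^ (2 * j) /
      (qPoch q (q ^ 2) j ^ 2 * qPoch (q ^ 2) (q ^ 2) j ^ 2 * (1 - q ^ (2 * j + 1))) =
      q / (1 - q) * jCas q j := by
    induction j with
    | zero => simp [qPoch, jCas]
    | succ j ih =>
      have b1 := one_sub_pow_ne_zero hq j
      have b2 := one_add_pow_ne_zero hq j
      have b3 := one_sub_pow_ne_zero hq (2 * j)
      have b4 := one_sub_pow_ne_zero hq (2 * j + 2)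
      have s1 : qPoch q q (j + 1) = qPoch q q j * (1 - q ^ (j + 1)) := by
        rw [qPoch, Finset.prod_range_succ, ← qPoch]; ring
      have s2 : qPoch q (q ^ 2) (j + 1) = qPoch q (q ^ 2) j * (1 - q ^ (2 * j + 1)) := by
        rw [qPoch, Finset.prod_range_succ, ← qPoch]; ring
      have s3 : qPoch (q ^ 2) (q ^ 2) (j + 1) =
          qPoch (q ^ 2) (q ^ 2) j * ((1 - q ^ (j + 1)) * (1 + q ^ (j + 1))) := by
        rw [qPoch, Finset.prod_range_succ, ← qPoch]; ring
      have s4 : jCas q (j + 1) = jCas q j * (jAB q j * q ^ 2) := by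
        rw [jCas, Finset.prod_range_succ, ← jCas]
      have b5 : qPoch q (q ^ 2) j ≠ 0 := Finset.prod_ne_zero_iff.mpr fun k _ => by
        rw [← pow_mul, ← pow_succ']
        exact one_sub_pow_ne_zero hq _
      have b6 : qPoch (q ^ 2) (q ^ 2) j ≠ 0 := Finset.prod_ne_zero_iff.mpr fun k _ => by
        rw [← pow_mul, ← pow_add, add_comm]
        exact one_sub_pow_ne_zero hq _
      rw [s1, s2, s3, s4, ← mul_assoc (q / (1 - q)), ← ih, jAB,
        show 2 * (j + 1) + 1 = 2 * j + 3 by ring]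
      rw [show 2 * j + 2 + 1 = 2 * j + 3 by ring] at b4
      generalize qPoch q q j = P1 at *
      generalize qPoch q (q ^ 2) j = P2 at *
      generalize qPoch (q ^ 2) (q ^ 2) j = P3 at *
      field_simp
      ring
  rw [D0Term, key, Dtilde_eq_jDenom h0 hq]
  field_simp

/-- The leading term is the summand `j = 0` of the telescoping sum. -/
theorem D0Head_eq {q : ℂ} (h0 : q ≠ 0) (hq : ‖q‖ ≤ 0.207) :
    D0Head q q = q / (1 - q) * (jCas q 0 / (jDenom q 0 * jDenom q 1)) := by
  have h1 : 1 + q ≠ 0 := by simpa using one_add_pow_ne_zero hq 0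
  have e : 1 - jC q 0 * q = 1 / (1 + q) := by
    simp only [jC, pow_zero, zero_add, pow_one]
    field_simp
    ring
  simp only [D0Head, jCas, jDenom, e]
  simp
  field_simp

theorem D0_eq {q : ℂ} (h0 : q ≠ 0) (hq : ‖q‖ ≤ 0.207) {h : ℕ} (hh : 1 ≤ h) :
    D0 h q q = q / (1 - q) *
      ∑ j ∈ Finset.range h, jCas q j / (jDenom q j * jDenom q (j + 1)) := by
  obtain ⟨h, rfl⟩ := Nat.exists_eq_add_of_le' hh
  rw [D0, Finset.sum_range_succ', mul_add, ← D0Head_eq h0 hq, add_comm, Finset.mul_sum,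
    add_tsub_cancel_right, ← Finset.Ico_add_one_right_eq_Icc, Finset.sum_Ico_eq_sum_range]
  simp only [add_tsub_cancel_right, add_comm 1, D0Term_eq h0 hq]

/-! ### The remainders -/

/-- The ratio of the normalizing constants `(1 - q) q^{n²} (q; q)_n² / (q; q)_{2n}` of the
remainders at `n + 1` and `n`. -/
def remRatio (q : ℂ) (n : ℕ) : ℂ :=
  q ^ (2 * n + 1) * (1 - q ^ (n + 1)) / ((1 - q ^ (2 * n + 1)) * (1 + q ^ (n + 1)))

/-- The coefficient of `z^{h+k}` in the remainder `Q_h(z) J(z) - P_h(z)`, where `P_h / Q_h` is the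
`h`-th convergent of `J(z) = ∑_k (1 - q) z^k / (1 - q^{k+1})`. Up to the normalizing constant it is
`∏_{i<h} (1 - q^{k-i}) / ∏_{i≤h} (1 - q^{k+1+i})`; in particular it vanishes for `k < h`. -/
def remCoeff (q : ℂ) : ℕ → ℕ → ℂ
  | 0, k => (1 - q) / (1 - q ^ (k + 1))
  | h + 1, k => remRatio q h * (1 - q ^ k / q ^ h) / (1 - q ^ (k + h + 2)) * remCoeff q h k

theorem remCoeff_eq_zero {q : ℂ} (h0 : q ≠ 0) {h k : ℕ} (hk : k < h) : remCoeff q h k = 0 := by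
  induction h with
  | zero => omega
  | succ h ih =>
    rw [remCoeff]
    rcases (Nat.lt_succ_iff.mp hk).eq_or_lt with rfl | hk
    · simp [h0]
    · simp [ih hk]

/-- The shift `k ↦ k + 1` of the product formula, cleared of the denominator `1 - q^{k+1-h}`, which
vanishes for `k + 1 = h`. -/
theorem remCoeff_shift {q : ℂ} (h0 : q ≠ 0) (hq : ‖q‖ ≤ 0.207) (h k : ℕ) :
    remCoeff q h (k + 1) * ((1 - q ^ (k + 1) / q ^ h) * (1 - q ^ (k + h + 2))) =
      remCoeff q h k * (1 - q ^ (k + 1)) ^ 2 := by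
  induction h with
  | zero =>
    have a1 := one_sub_pow_ne_zero hq k
    have a2 := one_sub_pow_ne_zero hq (k + 1)
    simp only [remCoeff, pow_zero, div_one, add_zero]
    field_simp
  | succ h ih =>
    have a1 : 1 - q ^ (k + h + 2) ≠ 0 := one_sub_pow_ne_zero hq (k + h + 1)
    have a2 : 1 - q ^ (k + h + 3) ≠ 0 := one_sub_pow_ne_zero hq (k + h + 2)
    have e : q ^ (k + 1) / q ^ (h + 1) = q ^ k / q ^ h := by
      rw [pow_succ, pow_succ, mul_div_mul_right _ _ h0]
    rw [remCoeff, remCoeff, e, show k + 1 + h + 2 = k + h + 3 by ring,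
      show k + (h + 1) + 2 = k + h + 3 by ring]
    calc _ = remRatio q h * (1 - q ^ k / q ^ h) * (remCoeff q h (k + 1) *
          ((1 - q ^ (k + 1) / q ^ h) * (1 - q ^ (k + h + 2)))) / (1 - q ^ (k + h + 2)) := by
          field_simp
      _ = _ := by rw [ih]; ring

/-- The coefficients of the remainders satisfy the recurrence of the J-fraction. -/
theorem remCoeff_add_two {q : ℂ} (h0 : q ≠ 0) (hq : ‖q‖ ≤ 0.207) (h k : ℕ) :
    remCoeff q (h + 2) k =
      remCoeff q (h + 1) (k + 1) - jC q (h + 1) * remCoeff q (h + 1) k -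
        jAB q h * remCoeff q h k := by
  have a1 : 1 - q ^ (k + h + 2) ≠ 0 := one_sub_pow_ne_zero hq (k + h + 1)
  have a2 : 1 - q ^ (k + h + 3) ≠ 0 := one_sub_pow_ne_zero hq (k + h + 2)
  have e : remCoeff q (h + 1) (k + 1) = remRatio q h * (1 - q ^ (k + 1)) ^ 2 /
      ((1 - q ^ (k + h + 2)) * (1 - q ^ (k + h + 3))) * remCoeff q h k := by
    rw [remCoeff, show k + 1 + h + 2 = k + h + 3 by ring]
    calc _ = remRatio q h * (remCoeff q h (k + 1) *
          ((1 - q ^ (k + 1) / q ^ h) * (1 - q ^ (k + h + 2)))) /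
          ((1 - q ^ (k + h + 2)) * (1 - q ^ (k + h + 3))) := by field_simp
      _ = _ := by rw [remCoeff_shift h0 hq]; ring
  rw [e, remCoeff, remCoeff, show k + (h + 1) + 2 = k + h + 3 by ring]
  have b1 := one_sub_pow_ne_zero hq (2 * h)
  have b2 : 1 - q ^ (2 * h + 3) ≠ 0 := one_sub_pow_ne_zero hq (2 * h + 2)
  have b3 := one_add_pow_ne_zero hq h
  have b4 : 1 + q ^ (h + 2) ≠ 0 := one_add_pow_ne_zero hq (h + 1)
  have hne : q ^ h ≠ 0 := pow_ne_zero _ h0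
  rw [remRatio, remRatio, jC, jAB, show 2 * (h + 1) + 1 = 2 * h + 3 by ring,
    show h + 1 + 1 = h + 2 from rfl]
  clear e
  simp only [pow_add, pow_mul', pow_one] at *
  generalize q ^ h = Y at *
  generalize q ^ k = X at *
  generalize hD₁ : 1 - X * Y * q ^ 2 = D₁ at *
  generalize hD₂ : 1 - X * Y * q ^ 3 = D₂ at *
  field_simp
  rw [← hD₁, ← hD₂]
  ring

theorem remCoeff_one {q : ℂ} (hq : ‖q‖ ≤ 0.207) (k : ℕ) :
    remCoeff q 1 k = remCoeff q 0 (k + 1) - jC q 0 * remCoeff q 0 k := by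
  have a1 := one_sub_pow_ne_zero hq k
  have a2 := one_sub_pow_ne_zero hq (k + 1)
  have a3 : 1 + q ≠ 0 := by simpa using one_add_pow_ne_zero hq 0
  have a4 : 1 - q ≠ 0 := by simpa using one_sub_pow_ne_zero hq 0
  simp only [remCoeff, remRatio, jC, mul_zero, zero_add, pow_zero, pow_one, add_zero, div_one]
  field_simp
  ring

theorem norm_remRatio_le {q : ℂ} (hq : ‖q‖ ≤ 0.207) (n : ℕ) : ‖remRatio q n‖ ≤ 0.4 := by
  have h1 := norm_one_sub_pow_ge hq (2 * n)
  have h3 := norm_one_add_pow_ge hq n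
  have h4 := norm_pow_succ_le hq (2 * n)
  have h5 := norm_one_sub_pow_le hq n
  rw [remRatio, norm_div, norm_mul, norm_mul]
  calc _ ≤ 0.207 * 1.207 / (0.793 * 0.793) := by gcongr
    _ ≤ (0.4 : ℝ) := by norm_num

theorem norm_remCoeff_le {q : ℂ} (h0 : q ≠ 0) (hq : ‖q‖ ≤ 0.207) (h k : ℕ) :
    ‖remCoeff q h k‖ ≤ 2 * 2 ^ h := by
  induction h with
  | zero =>
    have h1 := norm_one_sub_pow_ge hq k
    have h2 := norm_one_sub_pow_le hq 0
    rw [zero_add, pow_one] at h2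
    rw [remCoeff, norm_div, div_le_iff₀ (by linarith)]
    linarith
  | succ h ih =>
    -- the factor `1 - q^{k-h}` is unbounded for `k < h`, but there the coefficient vanishes
    rcases lt_or_ge k h with hk | hk
    · rw [remCoeff_eq_zero h0 (by omega), norm_zero]
      positivity
    · have h1 : 0.793 ≤ ‖1 - q ^ (k + h + 2)‖ := norm_one_sub_pow_ge hq (k + h + 1)
      have h2 := norm_remRatio_le hq h
      have h3 : ‖1 - q ^ k / q ^ h‖ ≤ 2 := by
        obtain ⟨d, rfl⟩ := Nat.exists_eq_add_of_le hk
        rw [pow_add, mul_div_cancel_left₀ _ (pow_ne_zero _ h0)]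
        refine (norm_sub_le _ _).trans ?_
        rw [norm_one, norm_pow]
        have := pow_le_one₀ (norm_nonneg q) (show ‖q‖ ≤ 1 by linarith) (n := d)
        linarith
      rw [remCoeff, norm_mul, norm_div, norm_mul]
      calc ‖remRatio q h‖ * ‖1 - q ^ k / q ^ h‖ / ‖1 - q ^ (k + h + 2)‖ * ‖remCoeff q h k‖
          ≤ 0.4 * 2 / 0.793 * (2 * 2 ^ h) := by gcongr
        _ ≤ 2 * (2 * 2 ^ h) := by gcongr; norm_num
        _ = 2 * 2 ^ (h + 1) := by ring

/-- The value at `z = q` of the remainder `Q_h(z) J(z) - P_h(z)`. -/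
def jRem (q : ℂ) (h : ℕ) : ℂ := ∑' k, remCoeff q h k * q ^ (h + k)

theorem norm_remCoeff_mul_pow_le {q : ℂ} (h0 : q ≠ 0) (hq : ‖q‖ ≤ 0.207) (h k : ℕ) :
    ‖remCoeff q h k * q ^ (h + k)‖ ≤ 2 * (2 * ‖q‖) ^ h * 0.207 ^ k := by
  rw [norm_mul, norm_pow, pow_add, mul_pow, ← mul_assoc, ← mul_assoc]
  gcongr
  exact norm_remCoeff_le h0 hq h k

theorem summable_remCoeff {q : ℂ} (h0 : q ≠ 0) (hq : ‖q‖ ≤ 0.207) (h : ℕ) :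
    Summable fun k => remCoeff q h k * q ^ (h + k) :=
  Summable.of_norm_bounded
    ((summable_geometric_of_lt_one (by norm_num) (by norm_num)).mul_left _)
    (norm_remCoeff_mul_pow_le h0 hq h)

theorem norm_jRem_le {q : ℂ} (h0 : q ≠ 0) (hq : ‖q‖ ≤ 0.207) (h : ℕ) :
    ‖jRem q h‖ ≤ 3 * (2 * ‖q‖) ^ h := by
  refine (tsum_of_norm_bounded ((hasSum_geometric_of_lt_one (by norm_num)
    (by norm_num)).mul_left _) (norm_remCoeff_mul_pow_le h0 hq h)).trans ?_
  have : 0 ≤ (2 * ‖q‖) ^ h := by positivity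
  norm_num
  linarith

theorem tsum_remCoeff_shift {q : ℂ} (h0 : q ≠ 0) (hq : ‖q‖ ≤ 0.207) (h : ℕ) :
    HasSum (fun k => remCoeff q h (k + 1) * q ^ (h + 1 + k))
      (jRem q h - remCoeff q h 0 * q ^ h) := by
  have := (hasSum_nat_add_iff' 1).mpr (summable_remCoeff h0 hq h).hasSum
  simpa [jRem, add_assoc, add_comm, add_left_comm] using this

theorem jRem_one {q : ℂ} (h0 : q ≠ 0) (hq : ‖q‖ ≤ 0.207) :
    jRem q 1 = (1 - jC q 0 * q) * jRem q 0 - 1 := by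
  have a4 : 1 - q ≠ 0 := by simpa using one_sub_pow_ne_zero hq 0
  have h1 := tsum_remCoeff_shift h0 hq 0
  have h2 := (summable_remCoeff h0 hq 0).hasSum.mul_left (jC q 0 * q)
  have h3 := (summable_remCoeff h0 hq 1).hasSum
  have e := h3.unique ((h1.sub h2).congr_fun fun k => by
    rw [remCoeff_one hq]
    ring)
  rw [← jRem] at e
  rw [e, ← jRem, remCoeff]
  simp [a4]
  ring

theorem jRem_add_two {q : ℂ} (h0 : q ≠ 0) (hq : ‖q‖ ≤ 0.207) (h : ℕ) :
    jRem q (h + 2) = (1 - jC q (h + 1) * q) * jRem q (h + 1) - jAB q h * q ^ 2 * jRem q h := by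
  have h1 := tsum_remCoeff_shift h0 hq (h + 1)
  have h2 := (summable_remCoeff h0 hq (h + 1)).hasSum.mul_left (jC q (h + 1) * q)
  have h3 := (summable_remCoeff h0 hq h).hasSum.mul_left (jAB q h * q ^ 2)
  have e := (summable_remCoeff h0 hq (h + 2)).hasSum.unique
    (((h1.sub h2).sub h3).congr_fun fun k => by
      rw [remCoeff_add_two h0 hq]
      ring)
  rw [← jRem, ← jRem, ← jRem, remCoeff_eq_zero h0 (Nat.succ_pos h)] at e
  rw [e]
  ring

/-- The denominators and the remainders solve the same recurrence, so their Casoratian is the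
product of the coefficients. -/
theorem casoratian {q : ℂ} (h0 : q ≠ 0) (hq : ‖q‖ ≤ 0.207) (h : ℕ) :
    jRem q h * jDenom q (h + 1) - jRem q (h + 1) * jDenom q h = jCas q h := by
  induction h with
  | zero =>
    simp only [zero_add, jDenom, jRem_one h0 hq, jCas]
    simp
    ring
  | succ h ih =>
    rw [jCas, Finset.prod_range_succ, ← jCas, ← ih, jRem_add_two h0 hq, jDenom]
    ring

theorem sum_jCas {q : ℂ} (h0 : q ≠ 0) (hq : ‖q‖ ≤ 0.207) (h : ℕ) :
    ∑ j ∈ Finset.range h, jCas q j / (jDenom q j * jDenom q (j + 1)) =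
      jRem q 0 - jRem q h / jDenom q h := by
  have h1 := jDenom_ne_zero hq
  rw [show jRem q 0 = jRem q 0 / jDenom q 0 by simp [jDenom],
    ← Finset.sum_range_sub' (fun j => jRem q j / jDenom q j)]
  refine Finset.sum_congr rfl fun j _ => ?_
  rw [← casoratian h0 hq, div_sub_div _ _ (h1 j) (h1 (j + 1))]
  ring

/-! ### Convergence to the Lambert series -/

/-- The Lambert series `∑_{n ≥ 1} q^n / (1 - q^n)`. -/
def lambert (q : ℂ) : ℂ := ∑' n : ℕ+, q ^ (n : ℕ) / (1 - q ^ (n : ℕ))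

theorem hasSum_lambert_jRem {q : ℂ} (h0 : q ≠ 0) (hq : ‖q‖ ≤ 0.207) :
    HasSum (fun n : ℕ+ => q ^ (n : ℕ) / (1 - q ^ (n : ℕ))) (q / (1 - q) * jRem q 0) := by
  have a4 : 1 - q ≠ 0 := by simpa using one_sub_pow_ne_zero hq 0
  have h := (summable_remCoeff h0 hq 0).hasSum.mul_left (q / (1 - q))
  rw [← Equiv.pnatEquivNat.symm.hasSum_iff]
  refine h.congr_fun fun k => ?_
  simp [remCoeff]
  field_simp
  ring

theorem hasSum_lambert {q : ℂ} (h0 : q ≠ 0) (hq : ‖q‖ ≤ 0.207) :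
    HasSum (fun n : ℕ+ => q ^ (n : ℕ) / (1 - q ^ (n : ℕ))) (lambert q) :=
  (hasSum_lambert_jRem h0 hq).summable.hasSum

theorem D0_eq_lambert_sub {q : ℂ} (h0 : q ≠ 0) (hq : ‖q‖ ≤ 0.207) {h : ℕ} (hh : 1 ≤ h) :
    D0 h q q = lambert q - q / (1 - q) * (jRem q h / jDenom q h) := by
  rw [D0_eq h0 hq hh, sum_jCas h0 hq, lambert, (hasSum_lambert_jRem h0 hq).tsum_eq]
  ring

theorem norm_jRem_div_jDenom_le {q : ℂ} (h0 : q ≠ 0) (hq : ‖q‖ ≤ 0.207) (h : ℕ) :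
    ‖jRem q h / jDenom q h‖ ≤ 3 * (3 * ‖q‖) ^ h := by
  rw [norm_div, div_le_iff₀ (norm_pos_iff.mpr (jDenom_ne_zero hq h))]
  calc ‖jRem q h‖ ≤ 3 * (2 * ‖q‖) ^ h := norm_jRem_le h0 hq h
    _ ≤ 3 * (3 * ‖q‖ * 0.7) ^ h := by gcongr 3 * ?_ ^ h; linarith [norm_nonneg q]
    _ = 3 * (3 * ‖q‖) ^ h * 0.7 ^ h := by rw [mul_pow _ (0.7 : ℝ)]; ring
    _ ≤ _ := by gcongr; exact norm_jDenom_ge hq h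

theorem norm_div_one_sub_le {q : ℂ} (hq : ‖q‖ ≤ 0.207) : ‖q / (1 - q)‖ ≤ 1 := by
  have h1 := norm_one_sub_pow_ge hq 0
  rw [zero_add, pow_one] at h1
  rw [norm_div, div_le_one (by linarith)]
  linarith

theorem norm_D0_sub_lambert_le {q : ℂ} (h0 : q ≠ 0) (hq : ‖q‖ ≤ 0.207) {h : ℕ} (hh : 1 ≤ h) :
    ‖D0 h q q - lambert q‖ ≤ 3 * (3 * ‖q‖) ^ h := by
  rw [D0_eq_lambert_sub h0 hq hh, sub_sub_cancel_left, norm_neg, norm_mul]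
  calc _ ≤ 1 * (3 * (3 * ‖q‖) ^ h) :=
        mul_le_mul (norm_div_one_sub_le hq) (norm_jRem_div_jDenom_le h0 hq h) (norm_nonneg _)
          zero_le_one
    _ = _ := one_mul _

theorem tendsto_D0 {q : ℂ} (h0 : q ≠ 0) (hq : ‖q‖ ≤ 0.207) :
    Filter.Tendsto (fun h : ℕ => D0 h q q) Filter.atTop (nhds (lambert q)) := by
  rw [tendsto_iff_norm_sub_tendsto_zero]
  have hlim : Filter.Tendsto (fun h : ℕ => 3 * (3 * ‖q‖) ^ h) Filter.atTop (nhds 0) := by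
    simpa using (tendsto_pow_atTop_nhds_zero_of_lt_one (r := 3 * ‖q‖) (by positivity)
      (by linarith)).const_mul 3
  refine squeeze_zero' (Filter.Eventually.of_forall fun _ => norm_nonneg _) ?_ hlim
  filter_upwards [Filter.eventually_ge_atTop 1] with h hh
  exact norm_D0_sub_lambert_le h0 hq hh

/-- Each summand is the difference of two truncations, both geometrically close to the limit. -/
theorem summable_D0Term {q : ℂ} (h0 : q ≠ 0) (hq : ‖q‖ ≤ 0.207) :
    Summable fun j : ℕ => D0Term q q (j + 1) := by
  refine Summable.of_norm_bounded (g := fun j => 6 * (3 * ‖q‖) ^ j)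
    ((summable_geometric_of_lt_one (by positivity) (by linarith)).mul_left _) fun j => ?_
  have e : D0Term q q (j + 1) =
      (D0 (j + 2) q q - lambert q) - (D0 (j + 1) q q - lambert q) := by
    rw [D0, D0, show j + 2 - 1 = j + 1 from rfl, show j + 1 - 1 = j from rfl,
      Finset.sum_Icc_succ_top (by omega)]
    ring
  have hp : ∀ i, (3 * ‖q‖) ^ (j + i) ≤ (3 * ‖q‖) ^ j := fun i =>
    pow_le_pow_of_le_one (by positivity) (by linarith) (by omega)
  rw [e]
  refine (norm_sub_le _ _).trans ?_
  have h1 := norm_D0_sub_lambert_le h0 hq (show 1 ≤ j + 2 by omega)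
  have h2 := norm_D0_sub_lambert_le h0 hq (show 1 ≤ j + 1 by omega)
  linarith [hp 1, hp 2]

theorem D0Inf_eq_lambert {q : ℂ} (h0 : q ≠ 0) (hq : ‖q‖ ≤ 0.207) : D0Inf q q = lambert q := by
  have h1 := (summable_D0Term h0 hq).hasSum.tendsto_sum_nat.const_add (D0Head q q)
  have h2 : ∀ n : ℕ, D0Head q q + ∑ j ∈ Finset.range n, D0Term q q (j + 1) = D0 (n + 1) q q := by
    intro n
    rw [D0, add_tsub_cancel_right, ← Finset.Ico_add_one_right_eq_Icc, Finset.sum_Ico_eq_sum_range]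
    simp only [add_tsub_cancel_right, add_comm 1]
  simp only [h2] at h1
  rw [D0Inf, tsum_pnat_eq_tsum_succ (f := D0Term q q)]
  exact tendsto_nhds_unique h1 ((tendsto_D0 h0 hq).comp (Filter.tendsto_add_atTop_nat 1))

theorem hasSum_divisors {q : ℂ} (hq : ‖q‖ ≤ 0.207) :
    HasSum (fun m : ℕ+ => ((m : ℕ).divisors.card : ℂ) * q ^ (m : ℕ)) (lambert q) := by
  have hlt : ‖q‖ < 1 := by linarith
  have h1 := tsum_pow_div_one_sub_eq_tsum_sigma hlt 0
  simp only [pow_zero, one_mul, ArithmeticFunction.sigma_zero_apply] at h1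
  rw [lambert, h1]
  refine Summable.hasSum (Summable.of_norm_bounded (g := fun m : ℕ+ => ‖(m : ℂ) ^ 1 * q ^ (m : ℕ)‖)
    ((summable_norm_pow_mul_geometric_of_norm_lt_one 1 hlt).subtype _) fun m => ?_)
  rw [norm_mul, norm_mul, pow_one, Complex.norm_natCast, Complex.norm_natCast]
  gcongr
  exact Nat.card_divisors_le_self m

/-! ### Taylor coefficients at the origin -/

open Filter Topology

/-- A convergent power series that is `O(q^h)` at the origin has no coefficient below degree `h`. -/
theorem coeff_eq_zero_of_norm_le {a : ℕ → ℂ} {f : ℂ → ℂ} {r C : ℝ} (hr : 0 < r) {h : ℕ}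
    (hf : ∀ q : ℂ, q ≠ 0 → ‖q‖ < r → HasSum (fun n => a n * q ^ n) (f q))
    (hC : ∀ q : ℂ, q ≠ 0 → ‖q‖ < r → ‖f q‖ ≤ C * ‖q‖ ^ h) {n : ℕ} (hn : n < h) : a n = 0 := by
  induction n using Nat.strong_induction_on with
  | _ n ih =>
    -- `g` is the power series divided by `q ^ n`: it takes the value `a n` at the origin
    set g : ℂ → ℂ := fun q => ∑' m, q ^ m * a (n + m) with hg
    have hsum : ∀ q : ℂ, q ≠ 0 → ‖q‖ < r → HasSum (fun m => q ^ m * a (n + m)) (f q / q ^ n) := by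
      intro q h0 hq
      have h1 := (hasSum_nat_add_iff' n).mpr (hf q h0 hq)
      rw [Finset.sum_eq_zero fun i hi => by
        rw [ih i (Finset.mem_range.mp hi) ((Finset.mem_range.mp hi).trans hn), zero_mul],
        sub_zero] at h1
      refine (h1.div_const (q ^ n)).congr_fun fun m => ?_
      have := pow_ne_zero n h0
      rw [pow_add, add_comm m n]
      field_simp
    have hball : ∀ᶠ q : ℂ in 𝓝 0, ‖q‖ < r := by
      filter_upwards [Metric.ball_mem_nhds (0 : ℂ) hr] with q hq
      simpa using hq
    have hp : HasFPowerSeriesAt g (FormalMultilinearSeries.ofScalars ℂ fun m => a (n + m)) 0 := by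
      rw [hasFPowerSeriesAt_iff]
      filter_upwards [hball] with q hq
      simp only [FormalMultilinearSeries.coeff_ofScalars, smul_eq_mul, zero_add]
      refine Summable.hasSum ?_
      by_cases h0 : q = 0
      · subst h0
        exact summable_of_ne_finset_zero (s := {0}) fun m hm => by
          simp [show m ≠ 0 by simpa using hm]
      · exact (hsum q h0 hq).summable
    have hg0 : g 0 = a n := by
      rw [hg]
      simp only
      rw [tsum_eq_single 0 fun m hm => by simp [hm]]
      simp
    have hlim : Tendsto g (𝓝[≠] 0) (𝓝 (a n)) := by
      rw [← hg0]
      exact hp.continuousAt.continuousWithinAt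
    have hlim0 : Tendsto g (𝓝[≠] 0) (𝓝 0) := by
      have hb : Tendsto (fun q : ℂ => C * ‖q‖ ^ (h - n)) (𝓝[≠] 0) (𝓝 0) := by
        have : ContinuousAt (fun q : ℂ => C * ‖q‖ ^ (h - n)) 0 := by fun_prop
        simpa [ContinuousAt, show h - n ≠ 0 by omega] using
          this.tendsto.mono_left nhdsWithin_le_nhds
      refine squeeze_zero_norm' ?_ hb
      filter_upwards [self_mem_nhdsWithin, nhdsWithin_le_nhds hball] with q h0 hq
      rw [hg]
      simp only
      rw [(hsum q h0 hq).tsum_eq, norm_div, norm_pow,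
        div_le_iff₀ (pow_pos (norm_pos_iff.mpr h0) n), mul_assoc, ← pow_add,
        Nat.sub_add_cancel hn.le]
      exact hC q h0 hq
    exact tendsto_nhds_unique hlim hlim0

theorem differentiableAt_jC {q : ℂ} (hq : ‖q‖ ≤ 0.207) (n : ℕ) :
    DifferentiableAt ℂ (fun q => jC q n) q := by
  have h : (1 + q ^ n) * (1 + q ^ (n + 1)) ≠ 0 :=
    mul_ne_zero (one_add_pow_ne_zero' hq n) (one_add_pow_ne_zero hq n)
  unfold jC
  fun_prop (disch := exact h)

theorem differentiableAt_jAB {q : ℂ} (hq : ‖q‖ ≤ 0.207) (n : ℕ) :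
    DifferentiableAt ℂ (fun q => jAB q n) q := by
  have h : (1 - q ^ (2 * n + 1)) * (1 + q ^ (n + 1)) ^ 2 * (1 - q ^ (2 * n + 3)) ≠ 0 :=
    mul_ne_zero (mul_ne_zero (one_sub_pow_ne_zero hq _) (pow_ne_zero _ (one_add_pow_ne_zero hq n)))
      (one_sub_pow_ne_zero hq _)
  unfold jAB
  fun_prop (disch := exact h)

theorem differentiableAt_jDenom {q : ℂ} (hq : ‖q‖ ≤ 0.207) :
    ∀ n : ℕ, DifferentiableAt ℂ (fun q => jDenom q n) q
  | 0 => by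
    simp only [jDenom]
    fun_prop
  | 1 => by
    have := differentiableAt_jC hq 0
    simp only [jDenom]
    fun_prop
  | n + 2 => by
    have h1 := differentiableAt_jC hq (n + 1)
    have h2 := differentiableAt_jAB hq n
    have h3 := differentiableAt_jDenom hq n
    have h4 := differentiableAt_jDenom hq (n + 1)
    simp only [jDenom]
    fun_prop

theorem differentiableAt_jCas {q : ℂ} (hq : ‖q‖ ≤ 0.207) (n : ℕ) :
    DifferentiableAt ℂ (fun q => jCas q n) q := by
  unfold jCas
  have := differentiableAt_jAB hq
  fun_prop

/-- The truncations extend holomorphically to the origin, hence are given by power series. -/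
theorem exists_powerSeries_D0 {h : ℕ} (hh : 1 ≤ h) :
    ∃ F : PowerSeries ℂ, ∀ q : ℂ, q ≠ 0 → ‖q‖ < 0.207 →
      HasSum (fun n => PowerSeries.coeff n F * q ^ n) (D0 h q q) := by
  set G : ℂ → ℂ := fun q => q / (1 - q) *
    ∑ j ∈ Finset.range h, jCas q j / (jDenom q j * jDenom q (j + 1)) with hG
  have hd : DifferentiableOn ℂ G (Metric.closedBall 0 (0.207 : NNReal)) := by
    intro q hq
    have hq : ‖q‖ ≤ 0.207 := by simpa using hq
    refine DifferentiableAt.differentiableWithinAt ?_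
    have h1 : 1 - q ≠ 0 := by simpa using one_sub_pow_ne_zero hq 0
    refine DifferentiableAt.mul (by fun_prop (disch := exact h1)) ?_
    refine DifferentiableAt.fun_sum fun j _ => ?_
    exact (differentiableAt_jCas hq j).div
      ((differentiableAt_jDenom hq j).mul (differentiableAt_jDenom hq (j + 1)))
      (mul_ne_zero (jDenom_ne_zero hq j) (jDenom_ne_zero hq (j + 1)))
  have hp := hd.hasFPowerSeriesOnBall (by norm_num)
  refine ⟨PowerSeries.mk fun n => (cauchyPowerSeries G 0 (0.207 : NNReal)).coeff n,
    fun q h0 hq => ?_⟩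
  have := hp.hasSum_sub (y := q) (by
    rw [Metric.mem_eball, edist_zero_right, ← ofReal_norm, ← ENNReal.ofReal_coe_nnreal]
    exact (ENNReal.ofReal_lt_ofReal_iff (by norm_num)).mpr (by simpa using hq))
  rw [D0_eq h0 hq.le hh]
  refine this.congr_fun fun n => ?_
  simp [mul_comm]

theorem coeff_eq_card_divisors {h : ℕ} (hh : 1 ≤ h) {F : PowerSeries ℂ}
    (hF : ∀ q : ℂ, q ≠ 0 → ‖q‖ < 0.207 →
      HasSum (fun n => PowerSeries.coeff n F * q ^ n) (D0 h q q)) {n : ℕ} (hn : n < h) :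
    PowerSeries.coeff n F = (n.divisors.card : ℂ) := by
  rw [← sub_eq_zero]
  refine coeff_eq_zero_of_norm_le (r := 0.207) (C := 3 * 3 ^ h) (by norm_num)
    (a := fun n => PowerSeries.coeff n F - (n.divisors.card : ℂ))
    (f := fun q => D0 h q q - lambert q) (fun q h0 hq => ?_) (fun q h0 hq => ?_) hn
  · have h1 : HasSum (fun m : ℕ => (m.divisors.card : ℂ) * q ^ m) (lambert q) := by
      have h2 := (Equiv.pnatEquivNat.symm.hasSum_iff).mpr (hasSum_divisors hq.le)
      have h3 := (hasSum_nat_add_iff (f := fun m : ℕ => (m.divisors.card : ℂ) * q ^ m) 1).mp h2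
      simpa using h3
    refine ((hF q h0 hq).sub h1).congr_fun fun m => ?_
    ring
  · rw [mul_assoc, ← mul_pow]
    exact norm_D0_sub_lambert_le h0 hq.le hh

end DivisorJFraction
end

theorem mainTheorem3 :
    (∀ q : ℂ, 0 < ‖q‖ → ‖q‖ < 0.206783 → ∀ j : ℕ, 1 ≤ j → DivisorJFraction.Dtilde q q j ≠ 0) ∧
    (∀ h : ℕ, 2 ≤ h → ∃ F : PowerSeries ℂ,
      (∀ q : ℂ, 0 < ‖q‖ → ‖q‖ < 0.206783 →
        HasSum (fun n : ℕ => PowerSeries.coeff n F * q ^ n) (DivisorJFraction.D0 h q q)) ∧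
      ∀ n : ℕ, n < h → PowerSeries.coeff n F = (n.divisors.card : ℂ)) ∧
    (∀ q : ℂ, 0 < ‖q‖ → ‖q‖ < 0.206783 →
      Summable (fun j : ℕ+ => DivisorJFraction.D0Term q q j) ∧
      Filter.Tendsto (fun h : ℕ => DivisorJFraction.D0 h q q) Filter.atTop
        (nhds (DivisorJFraction.D0Inf q q)) ∧
      HasSum (fun n : ℕ+ => q ^ (n : ℕ) / (1 - q ^ (n : ℕ))) (DivisorJFraction.D0Inf q q) ∧
      HasSum (fun m : ℕ+ => ((m : ℕ).divisors.card : ℂ) * q ^ (m : ℕ))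
        (DivisorJFraction.D0Inf q q)) := by
  have hle : ∀ {q : ℂ}, ‖q‖ < 0.206783 → ‖q‖ ≤ 0.207 := fun h => h.le.trans (by norm_num)
  refine ⟨fun q h0 hq j _ => ?_, fun h hh => ?_, fun q h0 hq => ?_⟩
  · rw [DivisorJFraction.Dtilde_eq_jDenom (norm_pos_iff.mp h0) (hle hq)]
    exact mul_ne_zero (DivisorJFraction.jDenom_ne_zero (hle hq) _)
      (DivisorJFraction.jDenom_ne_zero (hle hq) _)
  · obtain ⟨F, hF⟩ := DivisorJFraction.exists_powerSeries_D0 (one_le_two.trans hh)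
    exact ⟨F, fun q h0 hq => hF q (norm_pos_iff.mp h0) (hq.trans (by norm_num)),
      fun n hn => DivisorJFraction.coeff_eq_card_divisors (one_le_two.trans hh) hF hn⟩
  · have h0 := norm_pos_iff.mp h0
    rw [DivisorJFraction.D0Inf_eq_lambert h0 (hle hq)]
    refine ⟨?_, DivisorJFraction.tendsto_D0 h0 (hle hq),
      DivisorJFraction.hasSum_lambert h0 (hle hq), DivisorJFraction.hasSum_divisors (hle hq)⟩
    rw [← Equiv.pnatEquivNat.symm.summable_iff]
    exact DivisorJFraction.summable_D0Term h0 (hle hq)
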